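/- Let $T$ be a locally finite rooted tree (every vertex has finite degree) that is spherically homogeneous, meaning that any two vertices at the same distance from the root have the same degree. Let $\partial T$ be its boundary, i.e. the set of infinite paths without backtracking that start at the root, with the topology generated by the sets $C_v$ of all such paths through a given vertex $v$, and with the corresponding Borel structure. Suppose that $\partial T$ is infinite. Let $G$ be a finite group acting on $T$ by automorphisms fixing the root, and hence on $\partial T$. Then the space $\mathcal{M}^e_G$ of ergodic $G$-invariant Borel probability measures on $\partial T$ (those $G$-invariant Borel probability measures for which every $G$-invariant Borel set has measure $0$ or $1$), with the weak topology, is homeomorphic to the Cantor set. -/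

import Mathlib

open MeasureTheory

namespace RootedTreeBoundary

variable {V : Type*}

/-- A tree `T` with root `o` is spherically homogeneous if any two vertices of the same level (that
is, at the same combinatorial distance from the root) have the same degree. -/
def IsSphericallyHomogeneous (T : SimpleGraph V) [T.LocallyFinite] (o : V) : Prop :=
  ∀ v w : V, T.dist o v = T.dist o w → T.degree v = T.degree w

/-- The boundary of the tree `T` with root `o`: the infinite paths in `T` that start at the root
and have no backtracking. -/
@[ext]
structure Boundary (T : SimpleGraph V) (o : V) where
  vertex : ℕ → V
  vertex_zero : vertex 0 = o
  adj : ∀ n, T.Adj (vertex n) (vertex (n + 1))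
  no_backtracking : ∀ n, vertex (n + 2) ≠ vertex n

/-- The cylindrical set of all infinite paths in the boundary that go through the vertex `v`. -/
def cylinder (T : SimpleGraph V) (o : V) (v : V) : Set (Boundary T o) :=
  {ξ | ∃ n, ξ.vertex n = v}

/-- The topology of the boundary, generated by the cylindrical sets. -/
instance (T : SimpleGraph V) (o : V) : TopologicalSpace (Boundary T o) :=
  TopologicalSpace.generateFrom (Set.range (cylinder T o))

/-- The boundary carries its Borel structure. -/
instance (T : SimpleGraph V) (o : V) : MeasurableSpace (Boundary T o) :=
  borel (Boundary T o)

instance (T : SimpleGraph V) (o : V) : BorelSpace (Boundary T o) :=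
  ⟨rfl⟩

/-- The action of `G` on the vertices is an action on the rooted tree `T` by automorphisms
preserving the root `o`. -/
class ActsOnRootedTree (G : Type*) [Group G] [MulAction G V] (T : SimpleGraph V) (o : V) :
    Prop where
  adj_smul_iff : ∀ (g : G) (v w : V), T.Adj (g • v) (g • w) ↔ T.Adj v w
  smul_root : ∀ g : G, g • o = o

/-- The action on the boundary induced by an action on the rooted tree: an infinite path is moved
vertex by vertex. -/
instance (G : Type*) [Group G] [MulAction G V] (T : SimpleGraph V) (o : V)
    [ActsOnRootedTree G T o] : MulAction G (Boundary T o) where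
  smul g ξ :=
    { vertex := fun n => g • ξ.vertex n
      vertex_zero := by rw [ξ.vertex_zero, ActsOnRootedTree.smul_root T g]
      adj := fun n => (ActsOnRootedTree.adj_smul_iff o g _ _).2 (ξ.adj n)
      no_backtracking := fun n h => ξ.no_backtracking n (MulAction.injective g h) }
  one_smul ξ := Boundary.ext (funext fun n => one_smul G (ξ.vertex n))
  mul_smul g h ξ := Boundary.ext (funext fun n => mul_smul g h (ξ.vertex n))

/-- The set of ergodic invariant probability measures of an action of `G` on `X`: the probability
measures `μ` that are invariant under `G` and for which each `G`-invariant measurable set has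
measure 0 or 1. As a subset of `ProbabilityMeasure X` it carries the topology of weak
convergence. -/
def ergodicInvariantMeasures (G X : Type*) [Group G] [MulAction G X] [MeasurableSpace X] :
    Set (ProbabilityMeasure X) :=
  {μ | SMulInvariantMeasure G X (μ : Measure X) ∧
    ∀ s : Set X, MeasurableSet s → (∀ g : G, (fun x => g • x) ⁻¹' s = s) →
      (μ : Measure X) s = 0 ∨ (μ : Measure X) s = 1}

end RootedTreeBoundary

open Topology Filter
open scoped ENNReal BoundedContinuousFunction

/-! For finite `G` the ergodic measures are exactly the uniform measures on orbits. Countably many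
invariant clopen sets, the orbit cylinders, separate orbits; an ergodic measure gives each of them
mass 0 or 1, so it lives on a single orbit. Hence sending a point to its orbit measure is a
continuous surjection from the compact boundary with finite fibres. The image is compact, and an
isolated point of it would force one in the boundary. The masses of the orbit cylinders give clopen
sets separating the measures, so Brouwer's characterization applies.

The tree supplies two facts: `not_isOpen_singleton`, from infiniteness and homogeneity, and
`mem_orbit_of_forall_vertex_mem_orbit`, from finiteness of `G`. -/

/-! ### Brouwer's characterization of the Cantor space -/

/-- A characterization of the Cantor space: a nonempty compact space without isolated points, in
which countably many clopen sets separate points, is homeomorphic to `ℕ → Bool`. -/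
theorem nonempty_homeomorph_nat_bool_of_clopen_separating {X ι : Type*} [TopologicalSpace X]
    [CompactSpace X] [Nonempty X] [Countable ι] (U : ι → Set X) (hU : ∀ i, IsClopen (U i))
    (hsep : ∀ x y, (∀ i, x ∈ U i ↔ y ∈ U i) → x = y) (hperf : ∀ x : X, ¬ IsOpen {x}) :
    Nonempty (X ≃ₜ (ℕ → Bool)) := by
  classical
  have hι : Nonempty ι := by
    by_contra h
    rw [not_nonempty_iff] at h
    obtain ⟨x⟩ := ‹Nonempty X›
    refine hperf x ?_
    have : ({x} : Set X) = Set.univ := Set.eq_univ_of_forall fun y => hsep y x fun i => h.elim i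
    rw [this]
    exact isOpen_univ
  obtain ⟨e, he⟩ := exists_surjective_nat ι
  -- Cut `C` by `U (e n)` if that splits it; otherwise by any `U i` separating two points of `C`.
  -- Either way both pieces are nonempty and decided by `U (e n)`.
  have hsplit : ∀ (n : ℕ) (C : Set X), ∃ D : Set X, IsClopen C → C.Nonempty →
      IsClopen D ∧ (C ∩ D).Nonempty ∧ (C \ D).Nonempty ∧
      (C ∩ D ⊆ U (e n) ∨ C ∩ D ⊆ (U (e n))ᶜ) ∧ (C \ D ⊆ U (e n) ∨ C \ D ⊆ (U (e n))ᶜ) := by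
    intro n C
    by_cases hC : IsClopen C ∧ C.Nonempty
    swap
    · exact ⟨∅, fun h1 h2 => absurd ⟨h1, h2⟩ hC⟩
    obtain ⟨hC, x, hx⟩ := hC
    by_cases h1 : (C ∩ U (e n)).Nonempty ∧ (C \ U (e n)).Nonempty
    · exact ⟨U (e n), fun _ _ => ⟨hU _, h1.1, h1.2, Or.inl Set.inter_subset_right,
        Or.inr fun y hy => hy.2⟩⟩
    have h2 : C ⊆ U (e n) ∨ C ⊆ (U (e n))ᶜ := by
      by_contra! h
      refine h1 ⟨?_, Set.sdiff_nonempty.2 h.1⟩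
      obtain ⟨y, hy, hy'⟩ := Set.not_subset.1 h.2
      exact ⟨y, hy, not_not.1 hy'⟩
    obtain ⟨y, hy, hyx⟩ : ∃ y ∈ C, y ≠ x := by
      by_contra! h
      refine hperf x ?_
      have : ({x} : Set X) = C := (Set.eq_singleton_iff_unique_mem.2 ⟨hx, h⟩).symm
      rw [this]
      exact hC.isOpen
    obtain ⟨i, hi⟩ : ∃ i, ¬ (y ∈ U i ↔ x ∈ U i) := by
      by_contra! h
      exact hyx (hsep y x h)
    refine ⟨U i, fun _ _ => ⟨hU i, ?_, ?_, h2.imp (Set.inter_subset_left.trans ·)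
      (Set.inter_subset_left.trans ·), h2.imp (Set.sdiff_subset.trans ·)
      (Set.sdiff_subset.trans ·)⟩⟩
    · by_cases h : x ∈ U i
      · exact ⟨x, hx, h⟩
      · exact ⟨y, hy, by tauto⟩
    · by_cases h : x ∈ U i
      · exact ⟨y, hy, by tauto⟩
      · exact ⟨x, hx, h⟩
  choose D hD using hsplit
  -- `cell s n` is reached by following the bits of `s`, while `E x n` is the cell of depth `n`
  -- containing `x`. The homeomorphism `g` reads off the address of `x`.
  let cell : (ℕ → Bool) → ℕ → Set X := fun s n => Nat.rec Set.univ
    (fun n C => if s n then C ∩ D n C else C \ D n C) n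
  let E : X → ℕ → Set X := fun x n => Nat.rec Set.univ
    (fun n C => if x ∈ D n C then C ∩ D n C else C \ D n C) n
  have cell_succ : ∀ s n, cell s (n + 1) =
    if s n then cell s n ∩ D n (cell s n) else cell s n \ D n (cell s n) := fun _ _ => rfl
  have E_succ : ∀ x n, E x (n + 1) =
    if x ∈ D n (E x n) then E x n ∩ D n (E x n) else E x n \ D n (E x n) := fun _ _ => rfl
  have hcell : ∀ s n, IsClopen (cell s n) ∧ (cell s n).Nonempty := by
    intro s n
    induction n with
    | zero => exact ⟨isClopen_univ, Set.univ_nonempty⟩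
    | succ n ih =>
      obtain ⟨h1, h2, h3, -⟩ := hD n _ ih.1 ih.2
      rw [cell_succ]
      split_ifs
      · exact ⟨ih.1.inter h1, h2⟩
      · exact ⟨ih.1.diff h1, h3⟩
  have hE : ∀ x n, IsClopen (E x n) ∧ x ∈ E x n := by
    intro x n
    induction n with
    | zero => exact ⟨isClopen_univ, Set.mem_univ x⟩
    | succ n ih =>
      obtain ⟨h1, -⟩ := hD n _ ih.1 ⟨x, ih.2⟩
      rw [E_succ]
      split_ifs with h
      · exact ⟨ih.1.inter h1, ih.2, h⟩
      · exact ⟨ih.1.diff h1, ih.2, h⟩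
  have hDE : ∀ x n, IsClopen (D n (E x n)) := fun x n => (hD n _ (hE x n).1 ⟨x, (hE x n).2⟩).1
  have hmem : ∀ x n, ∀ᶠ y in 𝓝 x, (y ∈ D n (E x n) ↔ x ∈ D n (E x n)) := by
    intro x n
    by_cases h : x ∈ D n (E x n)
    · filter_upwards [(hDE x n).isOpen.mem_nhds h] with y hy using iff_of_true hy h
    · filter_upwards [(hDE x n).compl.isOpen.mem_nhds h] with y hy using iff_of_false hy h
  have hloc : ∀ n x, ∀ᶠ y in 𝓝 x, E y n = E x n := by
    intro n x
    induction n with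
    | zero => exact Eventually.of_forall fun _ => rfl
    | succ n ih =>
      filter_upwards [ih, hmem x n] with y h1 h2
      simp only [E_succ, h1, h2]
  let g : X → ℕ → Bool := fun x n => decide (x ∈ D n (E x n))
  have hg : Continuous g := by
    refine continuous_pi fun n => IsLocallyConstant.continuous ?_
    rw [IsLocallyConstant.iff_eventually_eq]
    intro x
    filter_upwards [hloc n x, hmem x n] with y h1 h2
    simp only [g, h1, h2]
  have hinj : Function.Injective g := by
    intro x y hxy
    have hiff : ∀ n, x ∈ D n (E x n) ↔ y ∈ D n (E y n) := fun n => by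
      simpa [g] using congrFun hxy n
    have hEE : ∀ n, E x n = E y n := by
      intro n
      induction n with
      | zero => rfl
      | succ n ih =>
        have h := hiff n
        rw [← ih] at h
        rw [E_succ, E_succ, ← ih, if_congr h rfl rfl]
    refine hsep x y fun i => ?_
    obtain ⟨n, rfl⟩ := he i
    have hx := (hE x (n + 1)).2
    have hy := (hE y (n + 1)).2
    rw [← hEE (n + 1)] at hy
    obtain ⟨-, -, -, h1, h2⟩ := hD n _ (hE x n).1 ⟨x, (hE x n).2⟩
    rw [E_succ] at hx hy
    split_ifs at hx hy
    · rcases h1 with h1 | h1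
      · exact iff_of_true (h1 hx) (h1 hy)
      · exact iff_of_false (h1 hx) (h1 hy)
    · rcases h2 with h2 | h2
      · exact iff_of_true (h2 hx) (h2 hy)
      · exact iff_of_false (h2 hx) (h2 hy)
  have hsurj : Function.Surjective g := by
    intro s
    obtain ⟨x, hx⟩ := IsCompact.nonempty_iInter_of_sequence_nonempty_isCompact_isClosed (cell s)
      (fun n => by rw [cell_succ]; split_ifs; exacts [Set.inter_subset_left, Set.sdiff_subset])
      (fun n => (hcell s n).2) (hcell s 0).1.isClosed.isCompact (fun n => (hcell s n).1.isClosed)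
    rw [Set.mem_iInter] at hx
    have hiff : ∀ n, x ∈ D n (cell s n) ↔ s n = true := by
      intro n
      have := hx (n + 1)
      rw [cell_succ] at this
      split_ifs at this with h
      · exact iff_of_true this.2 h
      · exact iff_of_false this.2 h
    have hEc : ∀ n, E x n = cell s n := by
      intro n
      induction n with
      | zero => rfl
      | succ n ih => rw [E_succ, cell_succ, ih, if_congr (hiff n) rfl rfl]
    refine ⟨x, funext fun n => ?_⟩
    rw [Bool.eq_iff_iff]
    simp only [g, decide_eq_true_eq, hEc, hiff]
  exact ⟨Continuous.homeoOfEquivCompactToT2 (f := Equiv.ofBijective g ⟨hinj, hsurj⟩) hg⟩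

/-! ### Uniform measures on orbits -/

section OrbitMeasure

variable (G : Type*) {X : Type*} [Group G] [Fintype G] [MulAction G X] [MeasurableSpace X]

/-- The uniform probability measure on the orbit of `x` under a finite group `G`. -/
noncomputable def orbitMeasure (x : X) : Measure X :=
  (Fintype.card G : ℝ≥0∞)⁻¹ • ∑ g : G, Measure.dirac (g • x)

theorem orbitMeasure_apply (x : X) {s : Set X} (hs : MeasurableSet s) :
    orbitMeasure G x s = (Fintype.card G : ℝ≥0∞)⁻¹ * ∑ g : G, s.indicator 1 (g • x) := by
  simp [orbitMeasure, Measure.dirac_apply' _ hs]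

theorem card_inv_mul_card_ennreal : (Fintype.card G : ℝ≥0∞)⁻¹ * Fintype.card G = 1 :=
  ENNReal.inv_mul_cancel (by simp) (by simp)

instance isProbabilityMeasure_orbitMeasure (x : X) : IsProbabilityMeasure (orbitMeasure G x) :=
  ⟨by simp [orbitMeasure_apply G x MeasurableSet.univ, card_inv_mul_card_ennreal]⟩

theorem orbitMeasure_apply_of_invariant (x : X) {s : Set X} (hs : MeasurableSet s)
    (hinv : ∀ g : G, (fun y => g • y) ⁻¹' s = s) : orbitMeasure G x s = s.indicator 1 x := by
  have h : ∀ g : G, s.indicator (1 : X → ℝ≥0∞) (g • x) = s.indicator 1 x := fun g => by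
    have : g • x ∈ s ↔ x ∈ s := by
      conv_rhs => rw [← hinv g]
      rfl
    by_cases hx : x ∈ s <;> simp [this, hx]
  simp only [orbitMeasure_apply G x hs, h, Finset.sum_const, Finset.card_univ, nsmul_eq_mul]
  rw [← mul_assoc, card_inv_mul_card_ennreal, one_mul]

theorem smulInvariantMeasure_orbitMeasure (hG : ∀ g : G, Measurable fun y : X => g • y) (x : X) :
    SMulInvariantMeasure G X (orbitMeasure G x) := by
  refine ⟨fun c s hs => ?_⟩
  rw [orbitMeasure_apply G x hs, orbitMeasure_apply G x (hG c hs)]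
  congr 1
  refine Fintype.sum_equiv (Equiv.mulLeft c) _ _ fun g => ?_
  by_cases h : c • g • x ∈ s <;> simp [mul_smul, h]

theorem orbitMeasure_smul (g : G) (x : X) : orbitMeasure G (g • x) = orbitMeasure G x := by
  unfold orbitMeasure
  congr 1
  refine Fintype.sum_equiv (Equiv.mulRight g) _ _ fun h => ?_
  simp [mul_smul]

/-- An invariant probability measure concentrated on one orbit is the uniform measure on it. -/
theorem eq_orbitMeasure_of_ae_mem_orbit (hG : ∀ g : G, Measurable fun y : X => g • y)
    (μ : Measure X) [IsProbabilityMeasure μ] [SMulInvariantMeasure G X μ] (x : X)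
    (h : ∀ᵐ y ∂μ, y ∈ MulAction.orbit G x) : μ = orbitMeasure G x := by
  ext s hs
  -- The sum of the indicator over translates is constant on an orbit; integrating it therefore
  -- gives its value at `x`.
  have key : ∑ g : G, ∫⁻ y, s.indicator 1 (g • y) ∂μ = Fintype.card G * μ s := by
    have : ∀ g : G, ∫⁻ y, s.indicator 1 (g • y) ∂μ = μ s := fun g => by
      rw [← SMulInvariantMeasure.measure_preimage_smul (μ := μ) g hs,
        ← lintegral_indicator_one (hG g hs)]
      rfl
    simp [this]
  have hm : ∀ g : G, Measurable fun y => s.indicator (1 : X → ℝ≥0∞) (g • y) :=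
    fun g => (measurable_one.indicator hs).comp (hG g)
  rw [← lintegral_finsetSum _ fun g _ => hm g] at key
  have h2 : ∫⁻ y, ∑ g : G, s.indicator 1 (g • y) ∂μ =
      ∫⁻ _, ∑ g : G, s.indicator 1 (g • x) ∂μ := by
    refine lintegral_congr_ae ?_
    filter_upwards [h] with y hy
    obtain ⟨k, rfl⟩ := hy
    refine Fintype.sum_equiv (Equiv.mulRight k) _ _ fun g => ?_
    simp [mul_smul]
  rw [h2, lintegral_const, measure_univ, mul_one] at key
  rw [orbitMeasure_apply G x hs, key, ← mul_assoc, card_inv_mul_card_ennreal, one_mul]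

/-- The uniform measure on an orbit, as a bundled probability measure. -/
noncomputable def orbitProbabilityMeasure (x : X) : ProbabilityMeasure X :=
  ⟨orbitMeasure G x, inferInstance⟩

theorem orbitProbabilityMeasure_mem_ergodicInvariantMeasures
    (hG : ∀ g : G, Measurable fun y : X => g • y) (x : X) :
    orbitProbabilityMeasure G x ∈ RootedTreeBoundary.ergodicInvariantMeasures G X := by
  refine ⟨smulInvariantMeasure_orbitMeasure G hG x, fun s hs hinv => ?_⟩
  change orbitMeasure G x s = 0 ∨ orbitMeasure G x s = 1
  rw [orbitMeasure_apply_of_invariant G x hs hinv]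
  by_cases h : x ∈ s <;> simp [h]

theorem continuous_orbitProbabilityMeasure [TopologicalSpace X] [BorelSpace X]
    [ContinuousConstSMul G X] :
    Continuous (orbitProbabilityMeasure G : X → ProbabilityMeasure X) := by
  rw [ProbabilityMeasure.continuous_iff_forall_continuous_integral]
  intro f
  have : ∀ x : X, ∫ y, f y ∂(orbitMeasure G x) =
      ((Fintype.card G : ℝ≥0∞)⁻¹).toReal • ∑ g : G, f (g • x) := fun x => by
    rw [orbitMeasure, integral_smul_measure, integral_finsetSum_measure]
    · simp only [integral_dirac' _ _ f.continuous.stronglyMeasurable]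
    · exact fun _ _ => f.integrable _
  simp only [orbitProbabilityMeasure, ProbabilityMeasure.coe_mk, this]
  have hg : ∀ g : G, Continuous fun x : X => f (g • x) := fun g =>
    f.continuous.comp (continuous_const_smul g)
  exact (continuous_finsetSum _ fun g _ => hg g).const_smul (Fintype.card G : ℝ≥0∞)⁻¹.toReal

end OrbitMeasure

/-! ### Ergodic measures of finite group actions -/

/-- The measure of a clopen set depends continuously on the probability measure. -/
theorem continuous_measureReal_of_isClopen {X : Type*} [TopologicalSpace X] [MeasurableSpace X]
    [BorelSpace X] {W : Set X} (hW : IsClopen W) :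
    Continuous fun μ : ProbabilityMeasure X => (μ : Measure X).real W := by
  let f : X →ᵇ ℝ := BoundedContinuousFunction.ofNormedAddCommGroup (W.indicator 1)
    ((IsLocallyConstant.const (1 : ℝ)).continuous.indicator (by simp [hW.frontier_eq])) 1
    (fun x => by by_cases h : x ∈ W <;> simp [h])
  convert ProbabilityMeasure.continuous_integral_boundedContinuousFunction f using 2 with μ
  exact (integral_indicator_one hW.isClosed.measurableSet).symm

/-- If a finite group acts continuously on a nonempty compact space without isolated points and
countably many invariant clopen sets separate the orbits, then the ergodic invariant probability
measures form a Cantor space. -/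
theorem nonempty_homeomorph_ergodicInvariantMeasures {G X ι : Type*} [Group G] [Finite G]
    [MulAction G X] [TopologicalSpace X] [MeasurableSpace X] [BorelSpace X] [T1Space X]
    [CompactSpace X] [Nonempty X] [ContinuousConstSMul G X] [Countable ι]
    (hperf : ∀ x : X, ¬ IsOpen {x}) (W : ι → Set X) (hW : ∀ i, IsClopen (W i))
    (hinv : ∀ (g : G) i, (fun x => g • x) ⁻¹' W i = W i)
    (hsep : ∀ x y, (∀ i, x ∈ W i ↔ y ∈ W i) → y ∈ MulAction.orbit G x) :
    Nonempty (RootedTreeBoundary.ergodicInvariantMeasures G X ≃ₜ (ℕ → Bool)) := by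
  classical
  have := Fintype.ofFinite G
  have hG : ∀ g : G, Measurable fun y : X => g • y := fun g =>
    (continuous_const_smul (T := X) g).measurable
  let φ : X → RootedTreeBoundary.ergodicInvariantMeasures G X := fun x =>
    ⟨orbitProbabilityMeasure G x, orbitProbabilityMeasure_mem_ergodicInvariantMeasures G hG x⟩
  have hφ : Continuous φ := (continuous_orbitProbabilityMeasure G).subtype_mk _
  have hval : ∀ x i, (((φ x : ProbabilityMeasure X) : Measure X) (W i) = 1 ↔ x ∈ W i) := by
    intro x i
    change orbitMeasure G x (W i) = 1 ↔ _
    rw [orbitMeasure_apply_of_invariant G x (hW i).isClosed.measurableSet (hinv · i)]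
    by_cases h : x ∈ W i <;> simp [h]
  have hsurj : Function.Surjective φ := by
    rintro ⟨μ, hμ, herg⟩
    change SMulInvariantMeasure G X (μ : Measure X) at hμ
    -- Each `A i` is the side of `W i` with full measure. Points of their intersection lie in one
    -- orbit.
    let A : ι → Set X := fun i => if (μ : Measure X) (W i) = 1 then W i else (W i)ᶜ
    have hA : ∀ᵐ x ∂(μ : Measure X), ∀ i, x ∈ A i := by
      rw [ae_all_iff]
      intro i
      rcases herg (W i) (hW i).isClosed.measurableSet (hinv · i) with h | h
      · simp only [A, h, zero_ne_one, if_false]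
        exact measure_eq_zero_iff_ae_notMem.1 h
      · simp only [A, h, if_true]
        exact (prob_compl_eq_zero_iff (hW i).isClosed.measurableSet).2 h
    obtain ⟨x, hx⟩ := hA.exists
    refine ⟨x, Subtype.ext (Subtype.ext
      (eq_orbitMeasure_of_ae_mem_orbit G hG (μ : Measure X) x ?_).symm)⟩
    filter_upwards [hA] with y hy
    refine hsep x y fun i => ?_
    have h1 := hx i
    have h2 := hy i
    simp only [A] at h1 h2
    split_ifs at h1 h2
    · exact iff_of_true h1 h2
    · exact iff_of_false h1 h2
  have hcompact : CompactSpace (RootedTreeBoundary.ergodicInvariantMeasures G X) :=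
    ⟨by rw [← hsurj.range_eq]; exact isCompact_range hφ⟩
  have hne : Nonempty (RootedTreeBoundary.ergodicInvariantMeasures G X) := ‹Nonempty X›.map φ
  have horb : ∀ x y, φ x = φ y → y ∈ MulAction.orbit G x := fun x y h =>
    hsep x y fun i => by rw [← hval, ← hval, h]
  refine nonempty_homeomorph_nat_bool_of_clopen_separating
    (fun i => {μ | ((μ : ProbabilityMeasure X) : Measure X) (W i) = 1}) (fun i => ?_) ?_ ?_
  · have hc : Continuous fun μ : RootedTreeBoundary.ergodicInvariantMeasures G X =>
        ((μ : ProbabilityMeasure X) : Measure X).real (W i) :=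
      (continuous_measureReal_of_isClopen (hW i)).comp continuous_subtype_val
    -- As ergodic measures take only the values 0 and 1 on `W i`, mass 1 is both a closed condition
    -- and the open condition of positive mass.
    have h1 : {μ : RootedTreeBoundary.ergodicInvariantMeasures G X |
        ((μ : ProbabilityMeasure X) : Measure X) (W i) = 1} =
        (fun μ : RootedTreeBoundary.ergodicInvariantMeasures G X =>
        ((μ : ProbabilityMeasure X) : Measure X).real (W i)) ⁻¹' {1} := by
      ext μ
      rcases μ.2.2 (W i) (hW i).isClosed.measurableSet (hinv · i) with h | h <;>
        simp [Measure.real, h]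
    have h2 : {μ : RootedTreeBoundary.ergodicInvariantMeasures G X |
        ((μ : ProbabilityMeasure X) : Measure X) (W i) = 1} =
        (fun μ : RootedTreeBoundary.ergodicInvariantMeasures G X =>
        ((μ : ProbabilityMeasure X) : Measure X).real (W i)) ⁻¹' (Set.Ioi 0) := by
      ext μ
      rcases μ.2.2 (W i) (hW i).isClosed.measurableSet (hinv · i) with h | h <;>
        simp [Measure.real, h]
    exact ⟨h1 ▸ isClosed_singleton.preimage hc, h2 ▸ isOpen_Ioi.preimage hc⟩
  · intro μ ν h
    obtain ⟨x, rfl⟩ := hsurj μ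
    obtain ⟨y, rfl⟩ := hsurj ν
    obtain ⟨g, rfl⟩ := hsep x y fun i => by rw [← hval, ← hval]; exact h i
    exact Subtype.ext (Subtype.ext (orbitMeasure_smul G g x).symm)
  · intro μ hμ
    obtain ⟨x, rfl⟩ := hsurj μ
    have hx : φ ⁻¹' {φ x} ∈ 𝓝 x := (hμ.preimage hφ).mem_nhds rfl
    refine hperf x (isOpen_singleton_of_finite_mem_nhds x hx <|
      (Set.finite_range fun g : G => g • x).subset ?_)
    intro y hy
    exact horb x y hy.symm

/-! ### Boundary paths and their topology -/

/-- In a tree with root `o`, a vertex has at most one neighbour that is closer to the root. -/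
theorem SimpleGraph.IsTree.eq_of_adj_of_dist_eq_succ {V : Type*} {T : SimpleGraph V}
    (hT : T.IsTree) {o a b v : V} (ha : T.Adj a v) (hb : T.Adj b v)
    (hda : T.dist o v = T.dist o a + 1) (hdb : T.dist o v = T.dist o b + 1) : a = b := by
  obtain ⟨p, hp⟩ := hT.connected.exists_walk_length_eq_dist o a
  obtain ⟨q, hq⟩ := hT.connected.exists_walk_length_eq_dist o b
  -- Geodesics to `a` and `b`, extended to `v`, must be the same path, hence have the same
  -- penultimate vertex.
  have hp' : (p.concat ha).IsPath :=
    (p.concat ha).isPath_of_length_eq_dist (by rw [Walk.length_concat, hp, hda])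
  have hq' : (q.concat hb).IsPath :=
    (q.concat hb).isPath_of_length_eq_dist (by rw [Walk.length_concat, hq, hdb])
  have h := congrArg Subtype.val
    ((hT.isAcyclic.subsingleton_path o v).elim ⟨_, hp'⟩ ⟨_, hq'⟩)
  simpa using congrArg Walk.penultimate h

namespace RootedTreeBoundary

variable {V : Type*} {T : SimpleGraph V} {o : V}

/-- A step towards the root would lead to the unique parent, which is the preceding vertex of the
path: a backtrack. -/
theorem dist_vertex (hT : T.IsTree) (ξ : Boundary T o) (n : ℕ) :
    T.dist o (ξ.vertex n) = n := by
  induction n using Nat.twoStepInduction with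
  | zero => rw [ξ.vertex_zero, SimpleGraph.dist_self]
  | one =>
    rw [SimpleGraph.dist_eq_one_iff_adj]
    simpa only [ξ.vertex_zero] using ξ.adj 0
  | more n h0 h1 =>
    rcases hT.dist_eq_dist_add_one_of_adj o (ξ.adj (n + 1)) with h | h
    · exact absurd (hT.eq_of_adj_of_dist_eq_succ (ξ.adj (n + 1)).symm (ξ.adj n) h
        (by rw [h0, h1])) (ξ.no_backtracking n)
    · rw [h, h1]

theorem vertex_eq_of_le (hT : T.IsTree) {ξ η : Boundary T o} {k n : ℕ} (hkn : k ≤ n)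
    (h : ξ.vertex n = η.vertex n) : ξ.vertex k = η.vertex k := by
  induction n, hkn using Nat.le_induction with
  | base => exact h
  | succ n _ ih =>
    refine ih (hT.eq_of_adj_of_dist_eq_succ (o := o) (ξ.adj n) (h ▸ η.adj n) ?_ ?_)
    · simp only [dist_vertex hT]
    · rw [h]
      simp only [dist_vertex hT]

theorem finite_range_vertex [T.LocallyFinite] (n : ℕ) :
    (Set.range fun ξ : Boundary T o => ξ.vertex n).Finite := by
  induction n with
  | zero =>
    refine (Set.finite_singleton o).subset ?_
    rintro _ ⟨ξ, rfl⟩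
    exact ξ.vertex_zero
  | succ n ih =>
    refine (ih.biUnion fun v _ => (T.neighborSet v).toFinite).subset ?_
    rintro _ ⟨ξ, rfl⟩
    exact Set.mem_biUnion ⟨ξ, rfl⟩ (ξ.adj n)

theorem isOpen_setOf_vertex_eq (hT : T.IsTree) (n : ℕ) (v : V) :
    IsOpen {ξ : Boundary T o | ξ.vertex n = v} := by
  by_cases hv : T.dist o v = n
  · have : {ξ : Boundary T o | ξ.vertex n = v} = cylinder T o v := by
      ext ξ
      refine ⟨fun h => ⟨n, h⟩, ?_⟩
      rintro ⟨m, rfl⟩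
      rw [dist_vertex hT] at hv
      rw [Set.mem_ofPred_eq, hv]
    rw [this]
    exact TopologicalSpace.isOpen_generateFrom_of_mem ⟨v, rfl⟩
  · have : {ξ : Boundary T o | ξ.vertex n = v} = ∅ := by
      refine Set.eq_empty_of_forall_notMem fun ξ h => hv ?_
      rw [← h, dist_vertex hT]
    rw [this]
    exact isOpen_empty

theorem isLocallyConstant_vertex (hT : T.IsTree) (n : ℕ) :
    IsLocallyConstant fun ξ : Boundary T o => ξ.vertex n :=
  IsLocallyConstant.iff_isOpen_fiber.2 (isOpen_setOf_vertex_eq hT n)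

/-- Identifies the cylinder topology with the one induced by a product of discrete spaces, so that
Tychonoff's theorem yields compactness. -/
theorem isEmbedding_vertex (hT : T.IsTree) [TopologicalSpace V] [DiscreteTopology V] :
    IsEmbedding (Boundary.vertex : Boundary T o → ℕ → V) := by
  refine ⟨⟨le_antisymm ?_ ?_⟩, fun ξ η h => Boundary.ext h⟩
  · exact continuous_iff_le_induced.1
      (continuous_pi fun n => (isLocallyConstant_vertex hT n).continuous)
  · refine le_generateFrom ?_
    rintro _ ⟨v, rfl⟩
    refine ⟨⋃ n, {x | x n = v}, isOpen_iUnion fun n => ?_, ?_⟩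
    · have hc : Continuous fun x : ℕ → V => x n := continuous_apply n
      exact (isOpen_discrete {v}).preimage hc
    · ext ξ
      simp [cylinder]

theorem isClosed_range_vertex [TopologicalSpace V] [DiscreteTopology V] :
    IsClosed (Set.range (Boundary.vertex : Boundary T o → ℕ → V)) := by
  have : Set.range (Boundary.vertex : Boundary T o → ℕ → V) =
      {x | x 0 = o} ∩ ⋂ n : ℕ, {x | T.Adj (x n) (x (n + 1))} ∩ {x | x (n + 2) ≠ x n} := by
    ext x
    simp only [Set.mem_inter_iff, Set.mem_iInter, Set.mem_ofPred_eq]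
    constructor
    · rintro ⟨ξ, rfl⟩
      exact ⟨ξ.vertex_zero, fun n => ⟨ξ.adj n, ξ.no_backtracking n⟩⟩
    · exact fun h => ⟨⟨x, h.1, fun n => (h.2 n).1, fun n => (h.2 n).2⟩, rfl⟩
  rw [this]
  have hc : ∀ n, Continuous fun x : ℕ → V => x n := fun n => continuous_apply n
  refine IsClosed.inter ?_ (isClosed_iInter fun n => IsClosed.inter ?_ ?_)
  · exact (isClosed_discrete {o}).preimage (hc 0)
  · exact (isClosed_discrete {p : V × V | T.Adj p.1 p.2}).preimage
      ((hc n).prodMk (hc (n + 1)))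
  · exact (isClosed_discrete {p : V × V | p.2 ≠ p.1}).preimage
      ((hc n).prodMk (hc (n + 2)))

theorem t2Space_boundary (hT : T.IsTree) : T2Space (Boundary T o) := by
  let : TopologicalSpace V := ⊥
  have : DiscreteTopology V := ⟨rfl⟩
  exact (isEmbedding_vertex hT).t2Space

theorem compactSpace_boundary (hT : T.IsTree) [T.LocallyFinite] :
    CompactSpace (Boundary T o) := by
  let : TopologicalSpace V := ⊥
  have : DiscreteTopology V := ⟨rfl⟩
  refine ⟨(isEmbedding_vertex hT).isCompact_iff.2 ?_⟩
  rw [Set.image_univ]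
  refine (isCompact_univ_pi fun n => (finite_range_vertex (T := T) (o := o) n).isCompact
    ).of_isClosed_subset isClosed_range_vertex ?_
  rintro _ ⟨ξ, rfl⟩ n -
  exact ⟨ξ, rfl⟩

theorem exists_forall_vertex_eq_imp_mem (hT : T.IsTree) {U : Set (Boundary T o)} (hU : IsOpen U)
    {ξ : Boundary T o} (hξ : ξ ∈ U) :
    ∃ n, ∀ η : Boundary T o, (∀ k ≤ n, η.vertex k = ξ.vertex k) → η ∈ U := by
  let : TopologicalSpace V := ⊥
  have : DiscreteTopology V := ⟨rfl⟩
  obtain ⟨O, hO, rfl⟩ := (isEmbedding_vertex hT).isInducing.isOpen_iff.1 hU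
  obtain ⟨I, u, hu, hIu⟩ := isOpen_pi_iff.1 hO ξ.vertex hξ
  refine ⟨I.sup id, fun η hη => hIu fun k hk => ?_⟩
  rw [hη k (Finset.le_sup (f := id) hk)]
  exact (hu k hk).2

/-! ### No isolated points in the boundary -/

section Homogeneous

variable [T.LocallyFinite]

/-- Below the root, `v` shares its degree, at least 2, with a vertex of `ξ`, and only one neighbour
can be its parent. -/
theorem exists_adj_dist_eq_succ (hT : T.IsTree) (hsph : IsSphericallyHomogeneous T o)
    (ξ : Boundary T o) (v : V) : ∃ w, T.Adj v w ∧ T.dist o w = T.dist o v + 1 := by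
  rcases h : T.dist o v with _ | k
  · obtain rfl := hT.connected.dist_eq_zero_iff.1 h
    refine ⟨ξ.vertex 1, ?_, dist_vertex hT ξ 1⟩
    simpa only [ξ.vertex_zero] using ξ.adj 0
  · have hdeg : 1 < T.degree v := by
      rw [hsph v (ξ.vertex (k + 1)) (by rw [h, dist_vertex hT]), SimpleGraph.degree,
        Finset.one_lt_card]
      exact ⟨ξ.vertex k, by simpa using (ξ.adj k).symm, ξ.vertex (k + 2),
        by simpa using ξ.adj (k + 1), (ξ.no_backtracking k).symm⟩
    obtain ⟨a, ha, b, hb, hab⟩ := Finset.one_lt_card.1 hdeg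
    rw [SimpleGraph.mem_neighborFinset] at ha hb
    rcases hT.dist_eq_dist_add_one_of_adj o ha with h1 | h1
    · rcases hT.dist_eq_dist_add_one_of_adj o hb with h2 | h2
      · exact absurd (hT.eq_of_adj_of_dist_eq_succ ha.symm hb.symm h1 h2) hab
      · exact ⟨b, hb, by rw [h2, h]⟩
    · exact ⟨a, ha, by rw [h1, h]⟩

/-- An initial segment of a boundary path can be continued through any child of its last vertex. -/
theorem exists_boundary_through (hT : T.IsTree) (hsph : IsSphericallyHomogeneous T o)
    (ξ : Boundary T o) {m : ℕ} {c : V} (hadj : T.Adj (ξ.vertex m) c)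
    (hc : T.dist o c = m + 1) :
    ∃ ζ : Boundary T o, (∀ k ≤ m, ζ.vertex k = ξ.vertex k) ∧ ζ.vertex (m + 1) = c := by
  choose child hchild hdist using exists_adj_dist_eq_succ hT hsph ξ
  let x : ℕ → V := fun k => if k ≤ m then ξ.vertex k else child^[k - (m + 1)] c
  have hx1 : ∀ k ≤ m, x k = ξ.vertex k := fun k hk => if_pos hk
  have hx2 : ∀ j, x (m + 1 + j) = child^[j] c := fun j => by
    simp only [x, if_neg (show ¬ m + 1 + j ≤ m by omega), Nat.add_sub_cancel_left]
  have hiter : ∀ j, T.dist o (child^[j] c) = m + 1 + j := fun j => by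
    induction j with
    | zero => exact hc
    | succ j ih => rw [Function.iterate_succ_apply', hdist, ih, add_assoc]
  have hxd : ∀ k, T.dist o (x k) = k := fun k => by
    rcases le_or_gt k m with hk | hk
    · rw [hx1 k hk, dist_vertex hT]
    · obtain ⟨j, rfl⟩ := Nat.exists_eq_add_of_le hk
      exact (congrArg _ (hx2 j)).trans (hiter j)
  refine ⟨⟨x, by rw [hx1 0 m.zero_le, ξ.vertex_zero], fun k => ?_, fun k h => ?_⟩, hx1, hx2 0⟩
  · rcases lt_trichotomy k m with hk | rfl | hk
    · rw [hx1 k hk.le, hx1 (k + 1) hk]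
      exact ξ.adj k
    · rw [hx1 k le_rfl, show x (k + 1) = c from hx2 0]
      exact hadj
    · obtain ⟨j, rfl⟩ := Nat.exists_eq_add_of_le hk
      have h1 : x (m.succ + j) = child^[j] c := hx2 j
      have h2 : x (m.succ + j + 1) = child (child^[j] c) := by
        rw [← Function.iterate_succ_apply' child]
        exact hx2 (j + 1)
      rw [h1, h2]
      exact hchild _
  · have := congrArg (T.dist o) h
    rw [hxd, hxd] at this
    omega

/-- By pigeonhole two paths agree through level `n + 1` and split later, so some deeper level has
degree above 2. By homogeneity `ξ` also branches there, giving another path in the given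
neighbourhood. -/
theorem not_isOpen_singleton (hT : T.IsTree) (hsph : IsSphericallyHomogeneous T o)
    [Infinite (Boundary T o)] (ξ : Boundary T o) : ¬ IsOpen {ξ} := by
  classical
  intro hξ
  obtain ⟨n, hn⟩ := exists_forall_vertex_eq_imp_mem hT hξ rfl
  obtain ⟨η, η', hηη', hne⟩ : ∃ η η' : Boundary T o,
      η.vertex (n + 1) = η'.vertex (n + 1) ∧ η ≠ η' := by
    have := (finite_range_vertex (T := T) (o := o) (n + 1)).to_subtype
    obtain ⟨η, η', hne, h⟩ := Finite.exists_ne_map_eq_of_infinite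
      (Set.rangeFactorization fun ξ : Boundary T o => ξ.vertex (n + 1))
    exact ⟨η, η', congrArg Subtype.val h, hne⟩
  have hdiff : ∃ k, η.vertex k ≠ η'.vertex k := by
    by_contra! h
    exact hne (Boundary.ext (funext h))
  have hspec := Nat.find_spec hdiff
  have hmin : ∀ k < Nat.find hdiff, η.vertex k = η'.vertex k := fun k hk =>
    not_not.1 (Nat.find_min hdiff hk)
  have hlt : n + 1 < Nat.find hdiff := by
    by_contra! h
    exact hspec (vertex_eq_of_le hT h hηη')
  -- The first difference is at level `j + 2`: the branching vertex is at level `j + 1` and its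
  -- parent at level `j`. Agreement at level `n + 1`, not just `n`, ensures that this parent exists.
  obtain ⟨j, hj⟩ := Nat.exists_eq_add_of_le' (show 2 ≤ Nat.find hdiff by omega)
  rw [hj] at hspec hmin hlt
  have h1 := hmin (j + 1) (by omega)
  have h0 := hmin j (by omega)
  have hdeg : 2 < T.degree (ξ.vertex (j + 1)) := by
    rw [hsph _ (η.vertex (j + 1)) (by simp only [dist_vertex hT]), SimpleGraph.degree,
      Finset.two_lt_card]
    refine ⟨η.vertex j, by simpa using (η.adj j).symm, η.vertex (j + 2),
      by simpa using η.adj (j + 1), η'.vertex (j + 2), ?_, (η.no_backtracking j).symm, ?_, hspec⟩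
    · rw [h1]
      simpa using η'.adj (j + 1)
    · rw [h0]
      exact (η'.no_backtracking j).symm
  obtain ⟨c, hc, hc'⟩ := Finset.exists_mem_notMem_of_card_lt_card
    (show ({ξ.vertex j, ξ.vertex (j + 2)} : Finset V).card <
      (T.neighborFinset (ξ.vertex (j + 1))).card from Finset.card_le_two.trans_lt hdeg)
  rw [SimpleGraph.mem_neighborFinset] at hc
  simp only [Finset.mem_insert, Finset.mem_singleton, not_or] at hc'
  have hcd : T.dist o c = j + 1 + 1 := by
    rcases hT.dist_eq_dist_add_one_of_adj o hc with h | h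
    · exact absurd (hT.eq_of_adj_of_dist_eq_succ hc.symm (ξ.adj j) h
        (by simp only [dist_vertex hT])) hc'.1
    · rw [h, dist_vertex hT]
  obtain ⟨ζ, hζ, hζc⟩ := exists_boundary_through hT hsph ξ hc hcd
  have : ζ = ξ := hn ζ fun k hk => hζ k (by omega)
  exact hc'.2 (by rw [← hζc, this])

end Homogeneous

/-! ### The group action and orbit cylinders -/

section Action

variable {G : Type*} [Group G] [MulAction G V]

/-- The boundary paths whose vertex of level `n` lies in the orbit of `v`. -/
def orbitCylinder (G : Type*) [Group G] [MulAction G V] (T : SimpleGraph V) (o : V)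
    (n : ℕ) (v : V) : Set (Boundary T o) :=
  {ξ | ξ.vertex n ∈ MulAction.orbit G v}

theorem isClopen_orbitCylinder (hT : T.IsTree) (n : ℕ) (v : V) :
    IsClopen (orbitCylinder G T o n v) :=
  ⟨⟨isLocallyConstant_vertex hT n (MulAction.orbit G v)ᶜ⟩,
    isLocallyConstant_vertex hT n (MulAction.orbit G v)⟩

variable [ActsOnRootedTree G T o]

theorem smul_vertex (g : G) (ξ : Boundary T o) (n : ℕ) :
    (g • ξ).vertex n = g • ξ.vertex n := rfl

theorem continuousConstSMul_boundary : ContinuousConstSMul G (Boundary T o) := by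
  refine ⟨fun g => continuous_generateFrom_iff.2 ?_⟩
  rintro _ ⟨v, rfl⟩
  have : (fun ξ : Boundary T o => g • ξ) ⁻¹' cylinder T o v = cylinder T o (g⁻¹ • v) := by
    ext ξ
    simp only [cylinder, Set.mem_preimage, Set.mem_ofPred_eq, smul_vertex, eq_inv_smul_iff]
  rw [this]
  exact TopologicalSpace.isOpen_generateFrom_of_mem ⟨_, rfl⟩

theorem smul_preimage_orbitCylinder (g : G) (n : ℕ) (v : V) :
    (fun ξ : Boundary T o => g • ξ) ⁻¹' orbitCylinder G T o n v = orbitCylinder G T o n v := by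
  ext ξ
  simp only [orbitCylinder, Set.mem_preimage, Set.mem_ofPred_eq, smul_vertex]
  rw [← MulAction.orbit_eq_iff, MulAction.orbit_smul, MulAction.orbit_eq_iff]

/-- For a finite group, two boundary paths that are in one orbit at each level are in one orbit. -/
theorem mem_orbit_of_forall_vertex_mem_orbit [Finite G] (hT : T.IsTree) {ξ η : Boundary T o}
    (h : ∀ n, η.vertex n ∈ MulAction.orbit G (ξ.vertex n)) : η ∈ MulAction.orbit G ξ := by
  have := Fintype.ofFinite G
  by_contra hη
  have hdiff : ∀ g : G, ∃ k, (g • ξ).vertex k ≠ η.vertex k := fun g => by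
    by_contra! h
    exact hη ⟨g, Boundary.ext (funext h)⟩
  choose k hk using hdiff
  -- Beyond all the disagreement levels some `g` still matches the vertices, and agreement passes
  -- down to `k g`.
  obtain ⟨g, hg⟩ := h (Finset.univ.sup k)
  exact hk g (vertex_eq_of_le hT (Finset.le_sup (Finset.mem_univ g)) hg)

end Action

end RootedTreeBoundary

theorem mainTheorem4 {V : Type*} (T : SimpleGraph V) (o : V) (hT : T.IsTree) [T.LocallyFinite]
    (hsph : RootedTreeBoundary.IsSphericallyHomogeneous T o)
    (hinf : Infinite (RootedTreeBoundary.Boundary T o))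
    (G : Type*) [Group G] [Finite G] [MulAction G V]
    [RootedTreeBoundary.ActsOnRootedTree G T o] :
    Nonempty (RootedTreeBoundary.ergodicInvariantMeasures G (RootedTreeBoundary.Boundary T o) ≃ₜ
      cantorSet) := by
  have := RootedTreeBoundary.t2Space_boundary (o := o) hT
  have := RootedTreeBoundary.compactSpace_boundary (o := o) hT
  have : ContinuousConstSMul G (RootedTreeBoundary.Boundary T o) :=
    RootedTreeBoundary.continuousConstSMul_boundary
  have (n : ℕ) : Countable (Set.range fun ξ : RootedTreeBoundary.Boundary T o => ξ.vertex n) :=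
    (RootedTreeBoundary.finite_range_vertex n).countable
  refine (nonempty_homeomorph_ergodicInvariantMeasures
    (RootedTreeBoundary.not_isOpen_singleton hT hsph)
    -- Only vertices visited by paths serve as indices; each level has finitely many, so the family
    -- is countable.
    (fun i : Σ n : ℕ, Set.range fun ξ : RootedTreeBoundary.Boundary T o => ξ.vertex n =>
      RootedTreeBoundary.orbitCylinder G T o i.1 i.2)
    (fun i => RootedTreeBoundary.isClopen_orbitCylinder hT i.1 i.2)
    (fun g i => RootedTreeBoundary.smul_preimage_orbitCylinder g i.1 (i.2 : V))
    fun ξ η h => RootedTreeBoundary.mem_orbit_of_forall_vertex_mem_orbit hT fun n => ?_).map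
    fun e => e.trans cantorSetHomeomorphNatToBool.symm
  exact (h ⟨n, ξ.vertex n, ξ, rfl⟩).1 (MulAction.mem_orbit_self _)
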